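/- **Theorem 4.1.** Let $n\ge 2$, let $\Omega\subset\mathbb R^n$ be a bounded domain (a non-empty connected open set), let $\rho(x)=d(x,\partial\Omega)$, and let $1<p<\infty$. Suppose that $\Omega$ supports Korn's inequality $(K_p)$: there is a constant $C_K>0$ such that $$\|D\mathbf v\|_{L^p(\Omega)}\le C_K\|\epsilon(\mathbf v)\|_{L^p(\Omega)}$$ for all $\mathbf v\in W^{1,p}(\Omega,\mathbb R^n)$ with $\int_\Omega\kappa_{i,j}(\mathbf v)\,dx=0$ for $1\le i,j\le n$, where $D\mathbf v=(\partial v_i/\partial x_j)_{i,j}$ is the distributional gradient, $\epsilon(\mathbf v)=\frac12(D\mathbf v+D\mathbf v^T)$, $\kappa(\mathbf v)=\frac12(D\mathbf v-D\mathbf v^T)$, and matrices carry the norm $|S|=\max_{i,j}|s_{i,j}|$. Suppose moreover that $\Omega$ satisfies the separation property with distinguished point $x_0\in\Omega$: there is a constant $C_s\ge1$ such that for each $x\in\Omega$ there is a curve $\gamma:[0,1]\to\Omega$ with $\gamma(0)=x$, $\gamma(1)=x_0$, such that for each $t\in[0,1]$, with $B=B(\gamma(t),C_s\rho(\gamma(t)))$,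 either $\gamma([0,t])\subset B$, or no $y\in\gamma([0,t])\setminus B$ belongs to the component of $\Omega\setminus\partial B$ that contains $x_0$ (a condition that is void if $x_0\in\partial B$). Then $\Omega$ is a John domain with distinguished point $x_0$: there is a constant $C_J>0$ such that for each $x\in\Omega$ there is a curve $\gamma:[0,l]\to\Omega$, parametrised by arclength, with $\gamma(0)=x$, $\gamma(l)=x_0$ and $\rho(\gamma(t))\ge C_Jt$ for all $t\in[0,l]$. -/

import Mathlib

open scoped ENNReal ContDiff

namespace KornJohn

/-- `n`-dimensional Euclidean space. -/
abbrev Euc (n : ℕ) : Type := EuclideanSpace ℝ (Fin n)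

/-- The distance `ρ(x) = d(x, ∂Ω)` to the boundary of `Ω`. -/
noncomputable def bdryDist {n : ℕ} (Ω : Set (Euc n)) (x : Euc n) : ℝ :=
  Metric.infDist x (frontier Ω)

/-- `Ω` is a John domain with distinguished point `x₀`: there is a constant `C > 0` such that every
`x ∈ Ω` can be joined to `x₀` by a curve `γ : [0, l] → Ω` parametrised by arclength with
`ρ(γ(t)) ≥ C t` for all `t ∈ [0, l]`. -/
def IsJohnDomain {n : ℕ} (Ω : Set (Euc n)) (x₀ : Euc n) : Prop :=
  IsOpen Ω ∧ IsConnected Ω ∧ Bornology.IsBounded Ω ∧ x₀ ∈ Ω ∧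
    ∃ C : ℝ, 0 < C ∧ ∀ x ∈ Ω, ∃ (l : ℝ) (γ : ℝ → Euc n), 0 ≤ l ∧
      HasUnitSpeedOn γ (Set.Icc 0 l) ∧ Set.MapsTo γ (Set.Icc 0 l) Ω ∧
      γ 0 = x ∧ γ l = x₀ ∧ ∀ t ∈ Set.Icc 0 l, C * t ≤ bdryDist Ω (γ t)

/-- The separation property of `Ω` with distinguished point `x₀`: there is a constant `C ≥ 1` such
that every `x ∈ Ω` can be joined to `x₀` by a curve `γ : [0, 1] → Ω` such that for each `t`, with
`B = B(γ(t), C ρ(γ(t)))`, either `γ([0, t]) ⊆ B`, or every `y ∈ γ([0, t]) \ B` lies outside the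
component of `Ω \ ∂B` that contains `x₀`. (`connectedComponentIn F x` is the component of `x` in
`F`, and is empty if `x ∉ F`.) -/
def SeparationProperty {n : ℕ} (Ω : Set (Euc n)) (x₀ : Euc n) : Prop :=
  x₀ ∈ Ω ∧ ∃ C : ℝ, 1 ≤ C ∧ ∀ x ∈ Ω, ∃ γ : ℝ → Euc n,
    ContinuousOn γ (Set.Icc 0 1) ∧ Set.MapsTo γ (Set.Icc 0 1) Ω ∧ γ 0 = x ∧ γ 1 = x₀ ∧
    ∀ t ∈ Set.Icc (0 : ℝ) 1,
      γ '' Set.Icc 0 t ⊆ Metric.ball (γ t) (C * bdryDist Ω (γ t)) ∨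
      ∀ y ∈ γ '' Set.Icc 0 t \ Metric.ball (γ t) (C * bdryDist Ω (γ t)),
        y ∉ connectedComponentIn (Ω \ Metric.sphere (γ t) (C * bdryDist Ω (γ t))) x₀

/-- `g` is the weak (distributional) partial derivative `∂f/∂x_j` on `Ω` (for `f` and `g` locally
integrable on `Ω`), by testing against smooth functions with compact support in `Ω`. -/
def HasWeakPartialDeriv {n : ℕ} (Ω : Set (Euc n)) (j : Fin n) (f g : Euc n → ℝ) : Prop :=
  ∀ φ : Euc n → ℝ, ContDiff ℝ ∞ φ → HasCompactSupport φ → tsupport φ ⊆ Ω →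
    ∫ x in Ω, f x * fderiv ℝ φ x (EuclideanSpace.single j 1) = -∫ x in Ω, g x * φ x

/-- `v ∈ W^{1,p}(Ω, ℝⁿ)`, with distributional gradient matrix `(D v)_{ij} = ∂v_i/∂x_j` given by `G`.
Matrices are functions `Fin n → Fin n → ℝ`, whose norm is the maximum of the absolute values of the
entries. -/
structure IsSobolevWithGradient {n : ℕ} (Ω : Set (Euc n)) (p : ℝ≥0∞)
    (v : Euc n → Euc n) (G : Euc n → Fin n → Fin n → ℝ) : Prop where
  memLp : MeasureTheory.MemLp v p (MeasureTheory.volume.restrict Ω)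
  memLp_gradient : MeasureTheory.MemLp G p (MeasureTheory.volume.restrict Ω)
  weakDeriv : ∀ i j, HasWeakPartialDeriv Ω j (fun x => v x i) (fun x => G x i j)

/-- The symmetric part `ε` of a gradient field. -/
noncomputable def symmPart {n : ℕ} (G : Euc n → Fin n → Fin n → ℝ) : Euc n → Fin n → Fin n → ℝ :=
  fun x i j => (G x i j + G x j i) / 2

/-- The antisymmetric part `κ` of a gradient field. -/
noncomputable def antisymmPart {n : ℕ} (G : Euc n → Fin n → Fin n → ℝ) :
    Euc n → Fin n → Fin n → ℝ :=
  fun x i j => (G x i j - G x j i) / 2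

/-- Korn's inequality `(K_p)` on `Ω`: there is a constant `C > 0` such that
`‖D v‖_{L^p(Ω)} ≤ C ‖ε(v)‖_{L^p(Ω)}` for all `v ∈ W^{1,p}(Ω, ℝⁿ)` with `∫_Ω κ_{ij}(v) dx = 0` for
all `i, j`. -/
def KornInequality {n : ℕ} (Ω : Set (Euc n)) (p : ℝ≥0∞) : Prop :=
  ∃ C : ℝ, 0 < C ∧ ∀ (v : Euc n → Euc n) (G : Euc n → Fin n → Fin n → ℝ),
    IsSobolevWithGradient Ω p v G →
    (∀ i j, ∫ x in Ω, antisymmPart G x i j = 0) →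
    MeasureTheory.eLpNorm G p (MeasureTheory.volume.restrict Ω) ≤
      ENNReal.ofReal C *
        MeasureTheory.eLpNorm (symmPart G) p (MeasureTheory.volume.restrict Ω)

end KornJohn

/-!
Korn's inequality limits how much of `Ω` can be cut off by a small sphere. Let `z ∈ Ω`, let `r` be
a fixed multiple of `ρ(z)`, and let `W` be the part of `Ω` outside `B(z, r)` that the sphere
`∂B(z, r)` separates from `x₀`. A rotation field `x ↦ A (x - z)`, with `A` antisymmetric, has
symmetric gradient zero; cut it off to zero near `B(z, r)`, and extend it by zero to the rest of
`Ω`. The symmetric gradient of the resulting field is bounded, by a constant independent of `z` and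
`r`, and vanishes outside `B(z, 2r)`, whereas its gradient is `A` on `W \ B(z, 2r)` and zero near
`x₀`. Korn's inequality holds for it after subtracting a constant matrix from the gradient
(`KornInequality.exists_sub_const`), and no constant is close to both `A` and zero. Hence
`|W \ B(z, 2r)| ≤ M ρ(z)ⁿ` (`KornInequality.exists_measureReal_le_bdryDist`).

Given a curve as in the separation property, let `y₀ = x, y₁, …, y_m` be the chain of points in
which `y_{i+1}` is the last point of the curve in the closed ball `B(y_i, ρ(y_i) / 2)`
(`exists_chain`). The balls `B(y_i, ρ(y_i) / 5)` are disjoint. For fixed `k`, those with `i < k`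
either lie within a bounded multiple of `ρ(y_k)` from `y_k`, or have parts separated from `x₀` by
the sphere around `y_k`; in both cases the volume is controlled, so `∑_{i<k} ρ(y_i)ⁿ ≤ C ρ(y_k)ⁿ`
for every `k` (`sum_bdryDist_pow_le`). A sequence whose partial sums are all dominated by the next
term grows geometrically, which allows the exponent to be dropped: `∑_{i≤k} ρ(y_i) ≤ C' ρ(y_k)`
(`sum_le_of_sum_pow_le`). Up to the factor one half, the left-hand side bounds the length of the
broken line through the `y_i` up to its `k`-th segment, and on that segment `ρ` is at least
`ρ(y_k) / 2`. So the broken line, followed to `x₀`, is a John curve (`exists_unitSpeed_polygon`).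
-/

namespace KornJohn

open Set Filter Topology MeasureTheory Metric

/-! ### Geometrically growing sequences -/

/-- If each `a k ^ n` dominates the sum of the preceding `n`-th powers up to a factor, then the
partial sums of `a k ^ n` grow geometrically, hence so do their `n`-th roots, which are comparable
to `a k`. The constant depends only on `n` and `M`. -/
theorem sum_le_of_sum_pow_le {n : ℕ} (hn : n ≠ 0) {M : ℝ} (hM : 0 ≤ M) :
    ∃ C : ℝ, 0 < C ∧ ∀ (a : ℕ → ℝ) (m : ℕ), (∀ i ≤ m, 0 < a i) →
      (∀ k ≤ m, ∑ i ∈ Finset.range k, a i ^ n ≤ M * a k ^ n) →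
      ∀ k ≤ m, ∑ i ∈ Finset.range (k + 1), a i ≤ C * a k := by
  have hn' : (0 : ℝ) < (n : ℝ)⁻¹ := by positivity
  set q : ℝ := (M / (M + 1)) ^ (n : ℝ)⁻¹ with hq
  have hq0 : 0 ≤ q := by positivity
  have hq1 : q < 1 := Real.rpow_lt_one (by positivity)
    ((div_lt_one (by positivity)).2 (by linarith)) hn'
  refine ⟨(M + 1) ^ (n : ℝ)⁻¹ / (1 - q), div_pos (by positivity) (by linarith), ?_⟩
  intro a m ha hsum
  set R : ℕ → ℝ := fun k => ∑ i ∈ Finset.range (k + 1), a i ^ n with hR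
  have hRs : ∀ k, R (k + 1) = R k + a (k + 1) ^ n := fun k => Finset.sum_range_succ _ _
  have hR0 : ∀ k ≤ m, 0 ≤ R k := fun k hk => Finset.sum_nonneg fun i hi => by
    have := ha i (by simp at hi; omega)
    positivity
  have hle : ∀ k ≤ m, R k ≤ (M + 1) * a k ^ n := fun k hk => by
    have := hsum k hk
    simp only [hR, Finset.sum_range_succ]
    linarith
  have hge : ∀ k ≤ m, a k ≤ R k ^ (n : ℝ)⁻¹ := fun k hk => by
    have h1 : a k ^ n ≤ R k := by
      simp only [hR, Finset.sum_range_succ]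
      have : 0 ≤ ∑ i ∈ Finset.range k, a i ^ n := Finset.sum_nonneg fun i hi => by
        have := ha i (by simp at hi; omega)
        positivity
      linarith
    calc a k = (a k ^ n) ^ (n : ℝ)⁻¹ := (Real.pow_rpow_inv_natCast (ha k hk).le hn).symm
      _ ≤ _ := Real.rpow_le_rpow (pow_nonneg (ha k hk).le _) h1 hn'.le
  have hstep : ∀ k, k + 1 ≤ m → R k ^ (n : ℝ)⁻¹ ≤ q * R (k + 1) ^ (n : ℝ)⁻¹ := fun k hk => by
    rw [hq, ← Real.mul_rpow (by positivity) (hR0 _ hk)]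
    refine Real.rpow_le_rpow (hR0 _ (by omega)) ?_ hn'.le
    have h1 := hle _ hk
    have h2 := hRs k
    rw [div_mul_eq_mul_div, le_div_iff₀ (by positivity)]
    nlinarith
  -- the terms `a i ≤ R i ^ (1 / n)` decay by the factor `q` going backwards from `k`
  have key : ∀ k ≤ m, (1 - q) * ∑ i ∈ Finset.range (k + 1), a i ≤ R k ^ (n : ℝ)⁻¹ := by
    intro k
    induction k with
    | zero =>
      intro hk
      have := hge 0 hk
      have := ha 0 hk
      simp only [zero_add, Finset.sum_range_one]
      nlinarith
    | succ k ih =>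
      intro hk
      have h1 := ih (by omega)
      have h2 := hge _ hk
      have h3 := hstep k hk
      rw [Finset.sum_range_succ]
      nlinarith
  intro k hk
  rw [div_mul_eq_mul_div, le_div_iff₀ (by linarith), mul_comm]
  refine (key k hk).trans ?_
  calc R k ^ (n : ℝ)⁻¹ ≤ ((M + 1) * a k ^ n) ^ (n : ℝ)⁻¹ :=
        Real.rpow_le_rpow (hR0 _ hk) (hle k hk) hn'.le
    _ = (M + 1) ^ (n : ℝ)⁻¹ * a k := by
        rw [Real.mul_rpow (by positivity) (pow_nonneg (ha k hk).le _),
          Real.pow_rpow_inv_natCast (ha k hk).le hn]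

/-! ### Chains along a curve -/

/-- The condition `s < 1` excludes the case in which the curve ends inside the ball. -/
theorem exists_last_exit {X : Type*} [PseudoMetricSpace X] {γ : ℝ → X}
    (hγ : ContinuousOn γ (Icc 0 1)) {d t : ℝ} (hd : 0 ≤ d) (ht : t ∈ Icc (0 : ℝ) 1) :
    ∃ s ∈ Icc t 1, dist (γ t) (γ s) ≤ d ∧ (s < 1 → ∀ u ∈ Icc s 1, d ≤ dist (γ t) (γ u)) := by
  have hsub : Icc t 1 ⊆ Icc (0 : ℝ) 1 := Icc_subset_Icc_left ht.1
  have hc : ContinuousOn (fun s => dist (γ t) (γ s)) (Icc t 1) :=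
    (continuous_const.dist continuous_id).comp_continuousOn (hγ.mono hsub)
  have hcpt : IsCompact (Icc t 1 ∩ (fun s => dist (γ t) (γ s)) ⁻¹' Iic d) :=
    isCompact_Icc.of_isClosed_subset (hc.preimage_isClosed_of_isClosed isClosed_Icc isClosed_Iic)
      inter_subset_left
  obtain ⟨s, ⟨hs, hsd⟩, hmax⟩ := hcpt.exists_isGreatest
    ⟨t, ⟨le_rfl, ht.2⟩, by simpa using hd⟩
  refine ⟨s, hs, hsd, fun hs1 => ?_⟩
  have hlt : ∀ u ∈ Ioc s 1, d ≤ dist (γ t) (γ u) := fun u hu => by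
    by_contra! h
    exact absurd (hmax ⟨⟨hs.1.trans hu.1.le, hu.2⟩, h.le⟩) (not_le.2 hu.1)
  -- the endpoint `u = s` is reached by continuity from the right
  rw [← closure_Ioc hs1.ne]
  intro u hu
  have hcl : closure (Ioc s 1) ⊆ Icc t 1 := by
    rw [closure_Ioc hs1.ne]; exact Icc_subset_Icc_left hs.1
  exact ContinuousWithinAt.closure_le hu continuousWithinAt_const
    ((hc u (hcl hu)).mono (subset_closure.trans hcl)) hlt

/-- A curve is followed by a finite chain of its points in which each point is the last exit of
the curve from a ball around the preceding one; later points stay outside that ball. -/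
theorem exists_chain {X : Type*} [PseudoMetricSpace X] {γ : ℝ → X}
    (hγ : ContinuousOn γ (Icc 0 1)) {d : ℝ → ℝ} (hd : ContinuousOn d (Icc 0 1))
    (hpos : ∀ t ∈ Icc (0 : ℝ) 1, 0 < d t) :
    ∃ (m : ℕ) (T : ℕ → ℝ), T 0 = 0 ∧ (∀ i, T i ∈ Icc (0 : ℝ) 1) ∧ Monotone T ∧
      (∀ i, ∀ j ≤ m, i < j → d (T i) ≤ dist (γ (T i)) (γ (T j))) ∧
      (∀ i, dist (γ (T i)) (γ (T (i + 1))) ≤ d (T i)) ∧ T (m + 1) = 1 := by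
  have hex : ∀ t : Icc (0 : ℝ) 1, ∃ s : Icc (0 : ℝ) 1, t ≤ s ∧ dist (γ t) (γ s) ≤ d t ∧
      ((s : ℝ) < 1 → ∀ u ∈ Icc (s : ℝ) 1, d t ≤ dist (γ t) (γ u)) := fun t => by
    obtain ⟨s, hs, h1, h2⟩ := exists_last_exit hγ (hpos t t.2).le t.2
    exact ⟨⟨s, t.2.1.trans hs.1, hs.2⟩, hs.1, h1, h2⟩
  choose next hle hdist hexit using hex
  set S : ℕ → Icc (0 : ℝ) 1 := fun i => next^[i] ⟨0, le_rfl, zero_le_one⟩ with hS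
  have hSs : ∀ i, S (i + 1) = next (S i) := fun i => Function.iterate_succ_apply' _ _ _
  have hmono : Monotone S := monotone_nat_of_le_succ fun i => by rw [hSs]; exact hle _
  -- otherwise the increasing parameters converge, and consecutive points get arbitrarily close,
  -- although they stay at distance at least `d`
  have hterm : ∃ m, (S (m + 1) : ℝ) = 1 := by
    by_contra! hne
    have hlt : ∀ i, (S (i + 1) : ℝ) < 1 := fun i => lt_of_le_of_ne (S (i + 1)).2.2 (hne i)
    have hlim := tendsto_atTop_ciSup hmono (OrderTop.bddAbove _)
    set L := ⨆ i, S i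
    have hγ' : Continuous fun t : Icc (0 : ℝ) 1 => γ t := continuousOn_iff_continuous_domRestrict.1 hγ
    have hd' : Continuous fun t : Icc (0 : ℝ) 1 => d t := continuousOn_iff_continuous_domRestrict.1 hd
    have h1 := (hγ'.tendsto L).comp hlim
    have h2 := h1.dist (h1.comp (tendsto_add_atTop_nat 1))
    have h3 := (hd'.tendsto L).comp hlim
    rw [dist_self] at h2
    refine absurd (le_of_tendsto_of_tendsto' h3 h2 fun i => ?_) (not_le.2 (hpos L L.2))
    have := hexit (S i) (by rw [← hSs]; exact hlt i) (S (i + 1)) ⟨by rw [hSs], (S (i + 1)).2.2⟩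
    exact this
  classical
  refine ⟨Nat.find hterm, fun i => S i, rfl, fun i => (S i).2, fun i j h => hmono h, ?_,
    fun i => ?_, Nat.find_spec hterm⟩
  · intro i j hj hij
    have hlt : (S (i + 1) : ℝ) < 1 :=
      lt_of_le_of_ne (S (i + 1)).2.2 (Nat.find_min hterm (m := i) (by omega))
    exact hexit (S i) (by rw [← hSs]; exact hlt) (S j)
      ⟨by rw [← hSs]; exact hmono (by omega), (S j).2.2⟩
  · simpa only [hSs] using hdist (S i)

/-! ### Curves of unit speed and the distance to the boundary -/

theorem hasUnitSpeedOn_ray {E : Type*} [NormedAddCommGroup E] [NormedSpace ℝ E] (x u : E)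
    (hu : ‖u‖ = 1) (l : ℝ) (s : Set ℝ) (hs : s.OrdConnected) :
    HasUnitSpeedOn (fun t => x + (t - l) • u) s := by
  have hiso : Isometry fun t : ℝ => x + (t - l) • u := Isometry.of_dist_eq fun a b => by
    rw [dist_add_left, dist_eq_norm, ← sub_smul, norm_smul, hu, mul_one, sub_sub_sub_cancel_right,
      Real.dist_eq, Real.norm_eq_abs]
  rw [HasUnitSpeedOn, hasConstantSpeedOnWith_iff_ordered]
  intro a ha b hb hab
  have hIcc : s ∩ Icc a b = Icc a b := inter_eq_right.2 (hs.out ha hb)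
  rw [hIcc, NNReal.coe_one, one_mul]
  refine le_antisymm ?_ ?_
  · have h1 := hiso.lipschitz.lipschitzOnWith.comp_eVariationOn_le (g := id) (s := Icc a b)
      (t := univ) (mapsTo_univ _ _)
    have h2 := (monotone_id.monotoneOn (Icc a b)).eVariationOn_eq (left_mem_Icc.2 hab)
      (right_mem_Icc.2 hab)
    rw [inter_self] at h2
    rwa [ENNReal.coe_one, one_mul, h2] at h1
  · have := eVariationOn.edist_le (fun t => x + (t - l) • u) (right_mem_Icc.2 hab)
      (left_mem_Icc.2 hab)
    rwa [hiso.edist_eq, edist_dist, Real.dist_eq, abs_of_nonneg (sub_nonneg.2 hab)] at this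

/-- A curve of unit speed may be prolonged by a line segment. -/
theorem HasUnitSpeedOn.exists_extend_segment {E : Type*} [NormedAddCommGroup E]
    [NormedSpace ℝ E] {γ : ℝ → E} {l : ℝ} (hl : 0 ≤ l) (hγ : HasUnitSpeedOn γ (Icc 0 l)) (y : E) :
    ∃ γ' : ℝ → E, HasUnitSpeedOn γ' (Icc 0 (l + dist (γ l) y)) ∧ EqOn γ' γ (Icc 0 l) ∧
      γ' (l + dist (γ l) y) = y ∧
      ∀ t ∈ Icc l (l + dist (γ l) y), dist (γ l) (γ' t) ≤ dist (γ l) y := by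
  rcases eq_or_ne (γ l) y with rfl | hne
  · simp only [dist_self, add_zero]
    refine ⟨γ, hγ, fun _ _ => rfl, rfl, fun t ht => ?_⟩
    obtain rfl : t = l := le_antisymm ht.2 ht.1
    simp
  set D := dist (γ l) y with hD
  have hDpos : 0 < D := dist_pos.2 hne
  have hDn : ‖y - γ l‖ = D := by rw [hD, dist_comm, dist_eq_norm]
  set u : E := D⁻¹ • (y - γ l) with hu
  have hu1 : ‖u‖ = 1 := by
    rw [hu, norm_smul, hDn, norm_inv, Real.norm_of_nonneg hDpos.le, inv_mul_cancel₀ hDpos.ne']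
  set γ' : ℝ → E := fun t => if t ≤ l then γ t else γ l + (t - l) • u with hγ'
  have h1 : EqOn γ' γ (Icc 0 l) := fun t ht => if_pos ht.2
  have h2 : EqOn γ' (fun t => γ l + (t - l) • u) (Icc l (l + D)) := fun t ht => by
    rcases ht.1.eq_or_lt with rfl | h
    · simp [hγ']
    · simp [hγ', not_le.2 h]
  have congr : ∀ {f g : ℝ → E} {s : Set ℝ}, EqOn f g s → HasUnitSpeedOn g s →
      HasUnitSpeedOn f s := fun {f g s} hfg hg a ha b hb => by
    rw [← hg ha hb]
    exact eVariationOn.congr (hfg.mono inter_subset_left)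
  refine ⟨γ', (congr h1 hγ).Icc_Icc (congr h2 (hasUnitSpeedOn_ray _ _ hu1 _ _ ordConnected_Icc)),
    h1, ?_, fun t ht => ?_⟩
  · rw [h2 ⟨by linarith, le_rfl⟩]
    simp only [add_sub_cancel_left, hu, smul_inv_smul₀ hDpos.ne']
    abel
  · rw [h2 ht, dist_self_add_right, norm_smul, hu1, mul_one, Real.norm_of_nonneg (by linarith [ht.1])]
    linarith [ht.2]

theorem ball_bdryDist_subset {n : ℕ} {Ω : Set (Euc n)} {x : Euc n} (hx : x ∈ Ω) :
    ball x (bdryDist Ω x) ⊆ Ω := by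
  rcases le_or_gt (bdryDist Ω x) 0 with h | h
  · simp [ball_eq_empty.2 h]
  refine ((convex_ball x (bdryDist Ω x)).isPreconnected.subset_left_of_subset_union
    isOpen_interior isClosed_closure.isOpen_compl
    (disjoint_compl_right_iff_subset.2 (interior_subset.trans subset_closure)) ?_ ?_).trans
    interior_subset
  · intro y hy
    by_cases h1 : y ∈ closure Ω
    · by_contra h2
      exact disjoint_ball_infDist.le_bot ⟨hy, h1, fun h => h2 (Or.inl h)⟩
    · exact Or.inr h1
  · refine ⟨x, mem_ball_self h, by_contra fun h2 => ?_⟩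
    exact disjoint_ball_infDist.le_bot ⟨mem_ball_self h, subset_closure hx, h2⟩

theorem bdryDist_le_add_dist {n : ℕ} (Ω : Set (Euc n)) (x y : Euc n) :
    bdryDist Ω x ≤ bdryDist Ω y + dist x y := infDist_le_infDist_add_dist

theorem continuous_bdryDist {n : ℕ} (Ω : Set (Euc n)) : Continuous (bdryDist Ω) :=
  continuous_infDist_pt _

theorem bdryDist_pos {n : ℕ} (hn : n ≠ 0) {Ω : Set (Euc n)} (hΩ : IsOpen Ω)
    (hb : Bornology.IsBounded Ω) {x : Euc n} (hx : x ∈ Ω) : 0 < bdryDist Ω x := by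
  have : NeZero n := ⟨hn⟩
  have hne : (frontier Ω).Nonempty := nonempty_frontier_iff.2 ⟨⟨x, hx⟩, fun h =>
    NormedSpace.unbounded_univ ℝ (Euc n) (h ▸ hb)⟩
  refine (isClosed_frontier.notMem_iff_infDist_pos hne).1 fun hxf => ?_
  exact (hΩ.inter_frontier_eq ▸ (⟨hx, hxf⟩ : x ∈ Ω ∩ frontier Ω) : x ∈ (∅ : Set (Euc n)))

/-- The broken line through the points of a chain is a John curve as soon as the distances to the
boundary, summed along the chain, are dominated by their last term. -/
theorem exists_unitSpeed_polygon {n : ℕ} {Ω : Set (Euc n)} {C : ℝ} (hC : 0 < C)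
    (y : ℕ → Euc n) (m : ℕ) (hy : ∀ i ≤ m, y i ∈ Ω) (hpos : ∀ i ≤ m, 0 < bdryDist Ω (y i))
    (hstep : ∀ i ≤ m, dist (y i) (y (i + 1)) ≤ bdryDist Ω (y i) / 2)
    (hsum : ∀ k ≤ m, ∑ i ∈ Finset.range (k + 1), bdryDist Ω (y i) ≤ C * bdryDist Ω (y k)) :
    ∃ (l : ℝ) (γ : ℝ → Euc n), 0 ≤ l ∧ HasUnitSpeedOn γ (Icc 0 l) ∧ MapsTo γ (Icc 0 l) Ω ∧
      γ 0 = y 0 ∧ γ l = y (m + 1) ∧ ∀ t ∈ Icc 0 l, C⁻¹ * t ≤ bdryDist Ω (γ t) := by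
  suffices H : ∀ k ≤ m + 1, ∃ (l : ℝ) (γ : ℝ → Euc n), 0 ≤ l ∧
      l ≤ (∑ i ∈ Finset.range k, bdryDist Ω (y i)) / 2 ∧ HasUnitSpeedOn γ (Icc 0 l) ∧
      MapsTo γ (Icc 0 l) Ω ∧ γ 0 = y 0 ∧ γ l = y k ∧
      ∀ t ∈ Icc 0 l, C⁻¹ * t ≤ bdryDist Ω (γ t) by
    obtain ⟨l, γ, h0, -, h⟩ := H (m + 1) le_rfl
    exact ⟨l, γ, h0, h⟩
  intro k
  induction k with
  | zero =>
    intro _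
    refine ⟨0, fun _ => y 0, le_rfl, by simp, ?_, fun _ _ => hy 0 (by omega), rfl, rfl, ?_⟩
    · exact hasConstantSpeedOnWith_of_subsingleton _ (by simp) _
    · intro t ht
      obtain rfl : t = 0 := le_antisymm ht.2 ht.1
      simpa using (hpos 0 (by omega)).le
  | succ k ih =>
    intro hk
    have hk' : k ≤ m := by omega
    obtain ⟨l, γ, hl, hlsum, hγ, hγΩ, h0, hlast, hJ⟩ := ih (by omega)
    obtain ⟨γ', hγ', heq, hend, hseg⟩ :=
      HasUnitSpeedOn.exists_extend_segment hl hγ (y (k + 1))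
    rw [hlast] at hγ' hend hseg
    have hD := hstep k hk'
    have hD0 : 0 ≤ dist (y k) (y (k + 1)) := dist_nonneg
    have hs := hsum k hk'
    rw [Finset.sum_range_succ] at hs
    have hp := hpos k hk'
    refine ⟨_, γ', by positivity, ?_, hγ', ?_, ?_, hend, ?_⟩
    · rw [Finset.sum_range_succ]; linarith
    · intro t ht
      rcases le_total t l with h | h
      · rw [heq ⟨ht.1, h⟩]; exact hγΩ ⟨ht.1, h⟩
      · apply ball_bdryDist_subset (hy k hk')
        have := hseg t ⟨h, ht.2⟩
        rw [mem_ball, dist_comm]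
        linarith
    · rw [heq ⟨le_rfl, hl⟩, h0]
    · intro t ht
      rcases le_total t l with h | h
      · rw [heq ⟨ht.1, h⟩]; exact hJ t ⟨ht.1, h⟩
      · have h1 := hseg t ⟨h, ht.2⟩
        have h2 := bdryDist_le_add_dist Ω (y k) (γ' t)
        rw [inv_mul_le_iff₀ hC]
        have h3 : t ≤ C * bdryDist Ω (y k) / 2 := by linarith [ht.2]
        have h4 : bdryDist Ω (y k) / 2 ≤ bdryDist Ω (γ' t) := by linarith
        nlinarith

/-! ### Korn's inequality for continuously differentiable fields -/

theorem hasWeakPartialDeriv_of_contDiffOn {n : ℕ} {Ω : Set (Euc n)} (hΩ : IsOpen Ω)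
    {f g : Euc n → ℝ} (hf : ContDiffOn ℝ 1 f Ω) (j : Fin n)
    (hg : ∀ x ∈ Ω, g x = fderiv ℝ f x (EuclideanSpace.single j 1)) :
    HasWeakPartialDeriv Ω j f g := by
  intro φ hφ hφc hφΩ
  have hint : ∀ h k : Euc n → ℝ, ContinuousOn h Ω → Continuous k → tsupport k ⊆ tsupport φ →
      Integrable fun x => h x * k x := fun h k hh hk hkφ => by
    have hsub : tsupport (fun x => h x * k x) ⊆ tsupport k :=
      closure_mono (Function.support_mul_subset_right h k)
    refine Continuous.integrable_of_hasCompactSupport ?_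
      (hφc.of_isClosed_subset (isClosed_tsupport _) (hsub.trans hkφ))
    refine continuous_of_tsupport fun x hx => ?_
    exact (hh.continuousAt (hΩ.mem_nhds (hφΩ (hkφ (hsub hx))))).mul hk.continuousAt
  have hfc := hf.continuousOn
  have hfd : ContinuousOn (fun x => fderiv ℝ f x (EuclideanSpace.single j 1)) Ω :=
    (hf.continuousOn_fderiv_of_isOpen hΩ le_rfl).clm_apply continuousOn_const
  have hφd : Continuous fun x => fderiv ℝ φ x (EuclideanSpace.single j 1) :=
    (hφ.continuous_fderiv (by simp)).clm_apply continuous_const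
  have hsupp : tsupport (fun x => fderiv ℝ φ x (EuclideanSpace.single j (1 : ℝ))) ⊆ tsupport φ :=
    tsupport_fderiv_apply_subset ℝ _
  have key := integral_mul_fderiv_eq_neg_fderiv_mul_of_integrable (μ := volume) (f := f) (g := φ)
    (v := EuclideanSpace.single j (1 : ℝ)) (hint _ φ hfd hφ.continuous le_rfl)
    (hint f _ hfc hφd hsupp) (hint f φ hfc hφ.continuous le_rfl)
    (fun x hx => (hf.differentiableOn one_ne_zero).differentiableAt (hΩ.mem_nhds (hφΩ hx)))
    (fun x _ => hφ.differentiable (by simp) x)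
  have hzero : ∀ x, x ∉ Ω → φ x = 0 := fun x hx =>
    image_eq_zero_of_notMem_tsupport fun h => hx (hφΩ h)
  have hzero' : ∀ x, x ∉ Ω → fderiv ℝ φ x (EuclideanSpace.single j 1) = 0 := fun x hx =>
    image_eq_zero_of_notMem_tsupport (f := fun x => fderiv ℝ φ x (EuclideanSpace.single j (1 : ℝ)))
      fun h => hx (hφΩ (hsupp h))
  rw [setIntegral_eq_integral_of_forall_compl_eq_zero fun x hx => by rw [hzero' x hx, mul_zero],
    key, ← setIntegral_eq_integral_of_forall_compl_eq_zero (s := Ω)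
      fun x hx => by rw [hzero x hx, mul_zero]]
  congr 1
  exact setIntegral_congr_fun hΩ.measurableSet fun x hx => by simp only [hg x hx]

/-- The matrix of partial derivatives `∂vᵢ/∂xⱼ` of a vector field. -/
noncomputable def grad {n : ℕ} (v : Euc n → Euc n) (x : Euc n) : Fin n → Fin n → ℝ :=
  fun i j => fderiv ℝ v x (EuclideanSpace.single j 1) i

theorem norm_grad_le {n : ℕ} (v : Euc n → Euc n) (x : Euc n) : ‖grad v x‖ ≤ ‖fderiv ℝ v x‖ := by
  refine (pi_norm_le_iff_of_nonneg (norm_nonneg _)).2 fun i =>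
    (pi_norm_le_iff_of_nonneg (norm_nonneg _)).2 fun j => ?_
  refine (PiLp.norm_apply_le _ i).trans ((ContinuousLinearMap.le_opNorm _ _).trans ?_)
  simp

theorem isSobolevWithGradient_grad {n : ℕ} {Ω : Set (Euc n)} (hΩ : IsOpen Ω)
    (hb : Bornology.IsBounded Ω) (p : ℝ≥0∞) {v : Euc n → Euc n} (hv : ContDiffOn ℝ 1 v Ω) {K : ℝ}
    (hvK : ∀ x ∈ Ω, ‖v x‖ ≤ K) (hdK : ∀ x ∈ Ω, ‖fderiv ℝ v x‖ ≤ K) :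
    IsSobolevWithGradient Ω p v (grad v) := by
  have : IsFiniteMeasure (volume.restrict Ω) :=
    ⟨by rw [Measure.restrict_apply_univ]; exact hb.measure_lt_top⟩
  have hd := hv.continuousOn_fderiv_of_isOpen hΩ le_rfl
  have hg : ContinuousOn (grad v) Ω := continuousOn_pi.2 fun i => continuousOn_pi.2 fun j =>
    (EuclideanSpace.proj (𝕜 := ℝ) i).continuous.comp_continuousOn
      (hd.clm_apply continuousOn_const)
  refine ⟨.of_bound (hv.continuousOn.aestronglyMeasurable hΩ.measurableSet) K
    (ae_restrict_of_forall_mem hΩ.measurableSet hvK),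
    .of_bound (hg.aestronglyMeasurable hΩ.measurableSet) K
      (ae_restrict_of_forall_mem hΩ.measurableSet fun x hx => (norm_grad_le v x).trans (hdK x hx)),
    fun i j => ?_⟩
  have hcomp : ContDiffOn ℝ 1 (fun x => v x i) Ω :=
    (EuclideanSpace.proj (𝕜 := ℝ) i).contDiff.comp_contDiffOn hv
  refine hasWeakPartialDeriv_of_contDiffOn hΩ hcomp j fun x hx => ?_
  have h1 := (hv.differentiableOn one_ne_zero).differentiableAt (hΩ.mem_nhds hx)
  have h2 := ((EuclideanSpace.proj (𝕜 := ℝ) i).hasFDerivAt.comp x h1.hasFDerivAt).fderiv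
  have h3 : fderiv ℝ (fun x => v x i) x =
    (EuclideanSpace.proj (𝕜 := ℝ) i).comp (fderiv ℝ v x) := h2
  rw [h3]
  rfl

/-- For an arbitrary `C¹` field Korn's inequality holds after subtracting a constant antisymmetric
matrix from the gradient, namely the mean of its antisymmetric part. -/
theorem KornInequality.exists_sub_const {n : ℕ} {Ω : Set (Euc n)} {p : ℝ≥0∞}
    (h : KornInequality Ω p) (hΩ : IsOpen Ω) (hne : Ω.Nonempty) (hb : Bornology.IsBounded Ω) :
    ∃ C : ℝ, 0 < C ∧ ∀ (v : Euc n → Euc n) (K : ℝ), ContDiffOn ℝ 1 v Ω →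
      (∀ x ∈ Ω, ‖v x‖ ≤ K) → (∀ x ∈ Ω, ‖fderiv ℝ v x‖ ≤ K) →
      ∃ Q : Fin n → Fin n → ℝ,
        eLpNorm (fun x => grad v x - Q) p (volume.restrict Ω) ≤
          ENNReal.ofReal C * eLpNorm (symmPart (grad v)) p (volume.restrict Ω) := by
  obtain ⟨C, hC, hK⟩ := h
  refine ⟨C, hC, fun v K hv hvK hdK => ?_⟩
  set V : ℝ := volume.real Ω with hV
  have hVtop : volume Ω ≠ ⊤ := hb.measure_lt_top.ne
  have hVpos : 0 < V := ENNReal.toReal_pos (hΩ.measure_pos volume hne).ne' hVtop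
  set Q : Fin n → Fin n → ℝ := fun i j => V⁻¹ * ∫ x in Ω, antisymmPart (grad v) x i j with hQ
  have hQanti : ∀ i j, Q i j + Q j i = 0 := fun i j => by
    have : ∀ x, antisymmPart (grad v) x j i = -antisymmPart (grad v) x i j := fun x => by
      simp only [antisymmPart]; ring
    simp only [hQ, this, integral_neg]
    ring
  set l : Euc n →L[ℝ] Euc n := Matrix.toEuclideanCLM (𝕜 := ℝ) (n := Fin n) (Matrix.of Q) with hl
  have hle : ∀ i j, l (EuclideanSpace.single j 1) i = Q i j := fun i j => by
    rw [hl, Matrix.ofLp_toEuclideanCLM]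
    simp [Matrix.mulVec_single]
  set v' : Euc n → Euc n := fun x => v x - l x with hv'
  have hv'c : ContDiffOn ℝ 1 v' Ω := hv.sub l.contDiff.contDiffOn
  have hfd : ∀ x ∈ Ω, fderiv ℝ v' x = fderiv ℝ v x - l := fun x hx =>
    ((((hv.differentiableOn one_ne_zero).differentiableAt (hΩ.mem_nhds hx)).hasFDerivAt).sub
      l.hasFDerivAt).fderiv
  have hgr : ∀ x ∈ Ω, grad v' x = grad v x - Q := fun x hx => by
    ext i j
    simp [grad, hfd x hx, hle]
  obtain ⟨R, hR⟩ := hb.exists_norm_le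
  have hS : IsSobolevWithGradient Ω p v' (grad v') := by
    refine isSobolevWithGradient_grad hΩ hb p hv'c (K := K + (‖l‖ * |R| + ‖l‖)) (fun x hx => ?_)
      fun x hx => ?_
    · have h1 := l.le_opNorm x
      have h2 : ‖l‖ * ‖x‖ ≤ ‖l‖ * |R| :=
        mul_le_mul_of_nonneg_left ((hR x hx).trans (le_abs_self R)) (norm_nonneg l)
      have h3 := norm_sub_le (v x) (l x)
      have h4 := hvK x hx
      have h5 := norm_nonneg l
      simp only [hv']
      linarith
    · rw [hfd x hx]
      have h3 := norm_sub_le (fderiv ℝ v x) l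
      have h4 := hdK x hx
      have h5 : 0 ≤ ‖l‖ * |R| := by positivity
      linarith
  have hint : ∀ i j, Integrable (fun x => antisymmPart (grad v) x i j) (volume.restrict Ω) := by
    intro i j
    have h1 := memLp_one_iff_integrable.1
      (isSobolevWithGradient_grad hΩ hb 1 hv hvK hdK).memLp_gradient
    exact (((h1.eval i).eval j).sub ((h1.eval j).eval i)).div_const 2
  have hmean : ∀ i j, ∫ x in Ω, antisymmPart (grad v') x i j = 0 := fun i j => by
    have h1 : ∀ x ∈ Ω, antisymmPart (grad v') x i j = antisymmPart (grad v) x i j - Q i j := by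
      intro x hx
      have := hQanti i j
      simp only [antisymmPart, hgr x hx, Pi.sub_apply]
      linarith
    have : IsFiniteMeasure (volume.restrict Ω) :=
      ⟨by rw [Measure.restrict_apply_univ]; exact hb.measure_lt_top⟩
    rw [setIntegral_congr_fun hΩ.measurableSet h1, integral_sub (hint i j) (integrable_const _),
      setIntegral_const, smul_eq_mul, ← hV]
    simp only [hQ]
    field_simp
    ring
  refine ⟨Q, ?_⟩
  have h1 : grad v' =ᵐ[volume.restrict Ω] fun x => grad v x - Q :=
    ae_restrict_of_forall_mem hΩ.measurableSet hgr
  have h2 : symmPart (grad v') =ᵐ[volume.restrict Ω] symmPart (grad v) :=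
    ae_restrict_of_forall_mem hΩ.measurableSet fun x hx => by
      ext i j
      have := hQanti i j
      simp only [symmPart, hgr x hx, Pi.sub_apply]
      linarith
  rw [← eLpNorm_congr_ae h1, ← eLpNorm_congr_ae h2]
  exact hK v' _ hS hmean

/-! ### The volume cut off by a sphere -/

/-- A smooth field that vanishes on a ball around the origin and is an infinitesimal rotation
outside a larger ball. -/
theorem exists_cutoff_rotation {n : ℕ} (hn : 2 ≤ n) :
    ∃ (w : Euc n → Euc n) (A : Fin n → Fin n → ℝ) (L : ℝ), ContDiff ℝ 1 w ∧
      (∀ y, ‖y‖ ^ 2 ≤ 2 → w y = 0) ∧ (∀ y, 2 ≤ ‖y‖ → grad w y = A) ∧ (1 ≤ ‖A‖) ∧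
      (∀ i j, A i j + A j i = 0) ∧ ∀ y, ‖fderiv ℝ w y‖ ≤ L := by
  obtain ⟨a, b, hab⟩ : ∃ a b : Fin n, a ≠ b := ⟨⟨0, by omega⟩, ⟨1, by omega⟩, by simp⟩
  set A : Matrix (Fin n) (Fin n) ℝ := Matrix.single a b 1 - Matrix.single b a 1 with hA
  set l : Euc n →L[ℝ] Euc n := Matrix.toEuclideanCLM (𝕜 := ℝ) (n := Fin n) A with hl
  set w : Euc n → Euc n := fun y => Real.smoothTransition (‖y‖ ^ 2 - 2) • l y with hw
  have hwc : ContDiff ℝ 1 w := by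
    refine ContDiff.smul (f := fun y : Euc n => Real.smoothTransition (‖y‖ ^ 2 - 2)) ?_ l.contDiff
    exact (Real.smoothTransition.contDiff (n := 1)).comp
      ((contDiff_norm_sq ℝ).sub contDiff_const)
  have hfar : ∀ y : Euc n, 2 ≤ ‖y‖ → fderiv ℝ w y = l := fun y hy => by
    -- the cutoff is constant from `‖x‖² = 3` on, so that `w = l` near every `y` with `2 ≤ ‖y‖`
    have : w =ᶠ[𝓝 y] l := by
      have hopen : IsOpen {x : Euc n | 3 < ‖x‖ ^ 2} :=
        isOpen_lt continuous_const (by fun_prop)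
      filter_upwards [hopen.mem_nhds (show 3 < ‖y‖ ^ 2 by nlinarith)] with x hx
      have hx' : (3 : ℝ) < ‖x‖ ^ 2 := hx
      simp only [hw]
      rw [Real.smoothTransition.one_of_one_le (by linarith), one_smul]
    rw [this.fderiv_eq, l.fderiv]
  obtain ⟨L, hL⟩ := (isCompact_closedBall (0 : Euc n) 2).exists_bound_of_continuousOn
    (hwc.continuous_fderiv (by simp)).continuousOn
  refine ⟨w, A, max L ‖l‖, hwc, fun y hy => ?_, fun y hy => ?_, ?_, fun i j => ?_, fun y => ?_⟩
  · simp only [hw]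
    rw [Real.smoothTransition.zero_of_nonpos (by linarith), zero_smul]
  · ext i j
    rw [grad, hfar y hy, hl, Matrix.ofLp_toEuclideanCLM]
    simp [Matrix.mulVec_single]
  · have h1 : A a b = 1 := by simp [hA, hab, hab.symm]
    have h2 := (norm_le_pi_norm (A a) b).trans (norm_le_pi_norm (f := (A : Fin n → Fin n → ℝ)) a)
    rw [h1, norm_one] at h2
    exact h2
  · simp only [hA, Matrix.sub_apply, Matrix.single_apply, and_comm]
    ring
  · rcases le_total ‖y‖ 2 with h | h
    · exact (hL y (by simpa using h)).trans (le_max_left _ _)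
    · rw [hfar y h]; exact le_max_right _ _

theorem contDiffOn_indicator {E F : Type*} [NormedAddCommGroup E] [NormedSpace ℝ E]
    [NormedAddCommGroup F] [NormedSpace ℝ F] {Ω W : Set E} {u : E → F} (hW : IsOpen W)
    (hu : ContDiff ℝ 1 u) (h0 : ∀ x ∈ Ω \ W, W.indicator u =ᶠ[𝓝 x] 0) :
    ContDiffOn ℝ 1 (W.indicator u) Ω ∧
      ∀ x ∈ Ω, fderiv ℝ (W.indicator u) x = W.indicator (fderiv ℝ u) x := by
  have h1 : ∀ x ∈ W, W.indicator u =ᶠ[𝓝 x] u := fun x hx =>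
    eventuallyEq_of_mem (hW.mem_nhds hx) fun y hy => indicator_of_mem hy u
  refine ⟨fun x hx => ?_, fun x hx => ?_⟩ <;> by_cases hxW : x ∈ W
  · exact (hu.contDiffAt.congr_of_eventuallyEq (h1 x hxW)).contDiffWithinAt
  · exact (contDiffAt_const.congr_of_eventuallyEq (h0 x ⟨hx, hxW⟩)).contDiffWithinAt
  · rw [(h1 x hxW).fderiv_eq, indicator_of_mem hxW]
  · rw [(h0 x ⟨hx, hxW⟩).fderiv_eq, indicator_of_notMem hxW]
    simp

theorem subset_connectedComponentIn_of_inter_nonempty {X : Type*} [TopologicalSpace X]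
    {F S : Set X} {x : X} (hS : IsPreconnected S) (hSF : S ⊆ F)
    (h : (S ∩ connectedComponentIn F x).Nonempty) : S ⊆ connectedComponentIn F x := by
  obtain ⟨y, hyS, hy⟩ := h
  rw [connectedComponentIn_eq hy]
  exact hS.subset_connectedComponentIn hyS hSF

/-- Korn's inequality bounds the part of `Ω` that the sphere `∂B(z, r)` cuts off from `x₀`: outside
the doubled ball it has at most the measure of that ball, up to a constant. The inequality is
tested with an infinitesimal rotation about `z`, cut off to zero near `B(z, r)` and extended by
zero to the component of `x₀`. -/
theorem KornInequality.exists_measure_le {n : ℕ} (hn : 2 ≤ n) {Ω : Set (Euc n)} {p : ℝ≥0∞}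
    (hp0 : p ≠ 0) (hptop : p ≠ ⊤) (h : KornInequality Ω p) (hΩ : IsOpen Ω)
    (hb : Bornology.IsBounded Ω) {x₀ : Euc n} {δ : ℝ} (hδ : 0 < δ) (hδΩ : ball x₀ δ ⊆ Ω) :
    ∃ M : ℝ≥0∞, M ≠ ⊤ ∧ ∀ (z : Euc n) (r : ℝ), 0 < r → r + δ ≤ dist x₀ z →
      ∀ E ⊆ Ω, Disjoint E (ball z (2 * r)) →
        Disjoint E (connectedComponentIn (Ω \ sphere z r) x₀) →
        volume E ≤ M * volume (closedBall z (2 * r)) := by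
  obtain ⟨w, A, L, hw, hw0, hwA, hA, hAanti, hL⟩ := exists_cutoff_rotation hn
  have hL0 : 0 ≤ L := (norm_nonneg _).trans (hL 0)
  obtain ⟨C, hC, hK⟩ := h.exists_sub_const hΩ ⟨x₀, hδΩ (mem_ball_self hδ)⟩ hb
  have hp : 0 < p.toReal := ENNReal.toReal_pos hp0 hptop
  set N : ℝ≥0∞ := (2 * (ENNReal.ofReal C * ENNReal.ofReal L)) ^ p.toReal with hN
  have hNtop : N ≠ ⊤ := by finiteness
  have hB0 : volume (ball x₀ δ) ≠ 0 := (measure_ball_pos volume x₀ hδ).ne'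
  have hVtop : volume Ω ≠ ⊤ := hb.measure_lt_top.ne
  refine ⟨max N (volume Ω / volume (ball x₀ δ) * N), by
    have := ENNReal.div_ne_top hVtop hB0
    exact (max_lt hNtop.lt_top (ENNReal.mul_lt_top this.lt_top hNtop.lt_top)).ne, ?_⟩
  intro z r hr hdist E hEΩ hEB hEU
  set U := connectedComponentIn (Ω \ sphere z r) x₀ with hU
  have hUopen : IsOpen U := (hΩ.sdiff isClosed_sphere).connectedComponentIn
  have hx₀far : ∀ x ∈ ball x₀ δ, r < dist x z := fun x hx => by
    have h1 := dist_triangle x₀ x z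
    rw [mem_ball, dist_comm] at hx
    linarith
  have hballU : ball x₀ δ ⊆ U :=
    (convex_ball x₀ δ).isPreconnected.subset_connectedComponentIn (mem_ball_self hδ)
      fun x hx => ⟨hδΩ hx, fun hs => (hx₀far x hx).ne' hs⟩
  set W : Set (Euc n) := (Ω \ closedBall z r) \ U with hW
  have hWopen : IsOpen W := by
    rw [Metric.isOpen_iff]
    rintro x ⟨hx, hxU⟩
    obtain ⟨ε, hε, hsub⟩ := Metric.isOpen_iff.1 (hΩ.sdiff (isClosed_closedBall (x := z) (ε := r))) x hx
    refine ⟨ε, hε, fun y hy => ⟨hsub hy, fun hyU => hxU ?_⟩⟩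
    have hsU : ball x ε ⊆ U :=
      subset_connectedComponentIn_of_inter_nonempty (convex_ball x ε).isPreconnected
        (fun q hq => ⟨(hsub hq).1, fun hs => (hsub hq).2 (sphere_subset_closedBall hs)⟩)
        ⟨y, hy, hyU⟩
    exact hsU (mem_ball_self hε)
  -- the factor `r` makes the gradient of the rescaled field independent of the scale
  set u : Euc n → Euc n := fun x => r • w (r⁻¹ • (x - z)) with hu
  have hucont : ContDiff ℝ 1 u :=
    (hw.comp ((contDiff_id.sub contDiff_const).const_smul r⁻¹)).const_smul r
  have hufd : ∀ x, fderiv ℝ u x = fderiv ℝ w (r⁻¹ • (x - z)) := fun x => by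
    have h1 : HasFDerivAt (fun x : Euc n => r⁻¹ • (x - z)) (r⁻¹ • ContinuousLinearMap.id ℝ (Euc n))
        x := ((hasFDerivAt_id x).sub_const z).const_smul r⁻¹
    have h2 := ((hw.differentiable (by simp) (r⁻¹ • (x - z))).hasFDerivAt.comp x h1).const_smul r
    refine h2.fderiv.trans ?_
    ext1 e
    simp [smul_smul, hr.ne']
  have hscale : ∀ x, ‖r⁻¹ • (x - z)‖ = dist x z / r := fun x => by
    rw [norm_smul, norm_inv, Real.norm_of_nonneg hr.le, dist_eq_norm, div_eq_inv_mul]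
  have hu0 : ∀ x ∈ Ω \ W, W.indicator u =ᶠ[𝓝 x] 0 := by
    rintro x ⟨hxΩ, hxW⟩
    by_cases hxU : x ∈ U
    · filter_upwards [hUopen.mem_nhds hxU] with y hy
      exact indicator_of_notMem (fun h => h.2 hy) u
    · have hxB : dist x z < 5 / 4 * r := by
        by_contra! h
        exact hxW ⟨⟨hxΩ, fun h' => by rw [mem_closedBall] at h'; linarith⟩, hxU⟩
      filter_upwards [isOpen_ball.mem_nhds (mem_ball.2 hxB)] with y hy
      have : u y = 0 := by
        simp only [hu]
        rw [hw0, smul_zero]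
        rw [hscale]
        have h1 : dist y z / r ≤ 5 / 4 := (div_le_iff₀ hr).2 (mem_ball.1 hy).le
        have h2 : 0 ≤ dist y z / r := by positivity
        nlinarith
      by_cases hyW : y ∈ W
      · rw [indicator_of_mem hyW, this, Pi.zero_apply]
      · exact indicator_of_notMem hyW u
  obtain ⟨hvC, hvd⟩ := contDiffOn_indicator hWopen hucont hu0
  set v := W.indicator u with hv
  have hgradW : ∀ x ∈ Ω, x ∈ W → grad v x = grad w (r⁻¹ • (x - z)) := fun x hx hxW => by
    ext i j
    rw [grad, grad, hvd x hx, indicator_of_mem hxW, hufd]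
  have hgradU : ∀ x ∈ Ω, x ∉ W → grad v x = 0 := fun x hx hxW => by
    ext i j
    simp [grad, hvd x hx, indicator_of_notMem hxW]
  have hfar : ∀ x ∈ Ω, x ∈ W → 2 * r ≤ dist x z → grad v x = A := fun x hx hxW hxd => by
    rw [hgradW x hx hxW, hwA]
    rwa [hscale, le_div_iff₀ hr]
  obtain ⟨K₁, hK₁⟩ := hb.isCompact_closure.exists_bound_of_continuousOn
    hucont.continuous.continuousOn
  have hvdL : ∀ x ∈ Ω, ‖fderiv ℝ v x‖ ≤ L := fun x hx => by
    rw [hvd x hx]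
    exact (norm_indicator_le_norm_self _ _).trans (hufd x ▸ hL _)
  obtain ⟨Q, hQ⟩ := hK v (max K₁ L) hvC
    (fun x hx => (norm_indicator_le_norm_self _ _).trans
      ((hK₁ x (subset_closure hx)).trans (le_max_left _ _)))
    (fun x hx => (hvdL x hx).trans (le_max_right _ _))
  -- the symmetric part lives in `B(z, 2r)`, where it is bounded independently of `z` and `r`
  have hsymm : eLpNorm (symmPart (grad v)) p (volume.restrict Ω) ≤
      ENNReal.ofReal L * volume (closedBall z (2 * r)) ^ (1 / p.toReal) := by
    have h1 : ∀ x ∈ Ω, ‖symmPart (grad v) x‖ ≤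
        (closedBall z (2 * r)).indicator (fun _ => L) x := fun x hx => by
      by_cases hxB : x ∈ closedBall z (2 * r)
      · rw [indicator_of_mem hxB]
        refine (pi_norm_le_iff_of_nonneg hL0).2 fun i => (pi_norm_le_iff_of_nonneg hL0).2 fun j => ?_
        have h2 : ∀ i j, |grad v x i j| ≤ L := fun i j =>
          ((norm_le_pi_norm (grad v x i) j).trans (norm_le_pi_norm (grad v x) i)).trans
            ((norm_grad_le v x).trans (hvdL x hx))
        have h3 := abs_le.1 (h2 i j)
        have h4 := abs_le.1 (h2 j i)
        rw [Real.norm_eq_abs, symmPart, abs_le]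
        constructor <;> linarith
      · rw [indicator_of_notMem hxB]
        have h2 : symmPart (grad v) x = 0 := by
          ext i j
          by_cases hxW : x ∈ W
          · have h3 : 2 * r ≤ dist x z := (not_le.1 hxB).le
            simp [symmPart, hfar x hx hxW h3, hAanti i j]
          · simp [symmPart, hgradU x hx hxW]
        rw [h2, norm_zero]
    refine (eLpNorm_mono_ae_real (ae_restrict_of_forall_mem hΩ.measurableSet h1)).trans ?_
    rw [eLpNorm_indicator_const measurableSet_closedBall hp0 hptop,
      Real.enorm_eq_ofReal hL0]
    gcongr
    exact Measure.restrict_le_self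
  set S : Set (Euc n) := {x | (2 : ℝ≥0∞)⁻¹ ≤ ‖grad v x - Q‖ₑ} with hS
  have hmeas : AEStronglyMeasurable (fun x => grad v x - Q) (volume.restrict Ω) := by
    refine (ContinuousOn.sub ?_ continuousOn_const).aestronglyMeasurable hΩ.measurableSet
    exact continuousOn_pi.2 fun i => continuousOn_pi.2 fun j =>
      (EuclideanSpace.proj (𝕜 := ℝ) i).continuous.comp_continuousOn
        ((hvC.continuousOn_fderiv_of_isOpen hΩ le_rfl).clm_apply continuousOn_const)
  have hScheb : volume.restrict Ω S ≤ N * volume (closedBall z (2 * r)) := by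
    refine (meas_ge_le_mul_pow_eLpNorm_enorm _ hp0 hptop hmeas (by simp) (by simp)).trans ?_
    rw [inv_inv, ← ENNReal.mul_rpow_of_nonneg _ _ hp.le]
    have h1 : 2 * eLpNorm (fun x => grad v x - Q) p (volume.restrict Ω) ≤
        2 * (ENNReal.ofReal C * ENNReal.ofReal L) *
          volume (closedBall z (2 * r)) ^ (1 / p.toReal) := by
      rw [mul_assoc, mul_assoc]
      gcongr
      exact hQ.trans (by gcongr)
    refine (ENNReal.rpow_le_rpow h1 hp.le).trans_eq ?_
    rw [ENNReal.mul_rpow_of_nonneg _ _ hp.le, ← ENNReal.rpow_mul, one_div,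
      inv_mul_cancel₀ hp.ne', ENNReal.rpow_one]
  have hsub : ∀ T ⊆ Ω, T ⊆ S → volume T ≤ N * volume (closedBall z (2 * r)) := fun T hT hTS => by
    refine le_trans ?_ hScheb
    rw [Measure.restrict_apply' hΩ.measurableSet]
    exact measure_mono (subset_inter hTS hT)
  have henorm : ∀ G : Fin n → Fin n → ℝ, 2⁻¹ ≤ ‖G‖ → (2 : ℝ≥0∞)⁻¹ ≤ ‖G‖ₑ := fun G hG => by
    rw [← ofReal_norm, ← ENNReal.ofReal_ofNat 2, ← ENNReal.ofReal_inv_of_pos two_pos]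
    exact ENNReal.ofReal_le_ofReal hG
  -- `Q` cannot be close both to `A`, the gradient on `E`, and to `0`, the gradient near `x₀`
  rcases le_or_gt 2⁻¹ ‖A - Q‖ with hAQ | hAQ
  · refine (hsub E hEΩ fun x hx => ?_).trans (by gcongr; exact le_max_left _ _)
    have h1 : 2 * r ≤ dist x z := not_lt.1 fun h => hEB.le_bot ⟨hx, h⟩
    have hxW : x ∈ W := ⟨⟨hEΩ hx, fun h => by rw [mem_closedBall] at h; linarith⟩,
      fun h => hEU.le_bot ⟨hx, h⟩⟩
    rw [hS, mem_ofPred_eq, hfar x (hEΩ hx) hxW h1]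
    exact henorm _ hAQ
  · have h1 : 2⁻¹ ≤ ‖(0 : Fin n → Fin n → ℝ) - Q‖ := by
      rw [zero_sub, norm_neg]
      have h2 := norm_le_norm_sub_add A Q
      norm_num at *
      linarith
    have h2 := hsub (ball x₀ δ) hδΩ fun x hx => by
      rw [hS, mem_ofPred_eq, hgradU x (hδΩ hx) fun h => h.2 (hballU hx)]
      exact henorm _ h1
    calc volume E ≤ volume Ω := measure_mono hEΩ
      _ = volume Ω / volume (ball x₀ δ) * volume (ball x₀ δ) :=
        (ENNReal.div_mul_cancel hB0 measure_ball_lt_top.ne).symm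
      _ ≤ volume Ω / volume (ball x₀ δ) * (N * volume (closedBall z (2 * r))) := by gcongr
      _ ≤ _ := by rw [← mul_assoc]; gcongr; exact le_max_right _ _

theorem volume_real_ball {n : ℕ} (hn : n ≠ 0) (x : Euc n) {r : ℝ} (hr : 0 ≤ r) :
    volume.real (ball x r) = r ^ n * volume.real (ball (0 : Euc n) 1) := by
  have : NeZero n := ⟨hn⟩
  rw [← Measure.addHaar_real_closedBall_eq_addHaar_real_ball,
    Measure.addHaar_real_closedBall _ _ hr, finrank_euclideanSpace_fin]

/-- The bound of `KornInequality.exists_measure_le` in terms of `ρ(z)`. It needs no condition on the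
position of `x₀`: if `x₀` is close to the ball around `z`, then `ρ(z)` is bounded below. -/
theorem KornInequality.exists_measureReal_le_bdryDist {n : ℕ} (hn : 2 ≤ n) {Ω : Set (Euc n)}
    {p : ℝ≥0∞} (hp0 : p ≠ 0) (hptop : p ≠ ⊤) (h : KornInequality Ω p) (hΩ : IsOpen Ω)
    (hb : Bornology.IsBounded Ω) {x₀ : Euc n} (hx₀ : x₀ ∈ Ω) {C : ℝ} (hC : 1 ≤ C) :
    ∃ M : ℝ, 0 ≤ M ∧ ∀ z ∈ Ω, ∀ E ⊆ Ω, Disjoint E (ball z (2 * (C * bdryDist Ω z))) →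
        Disjoint E (connectedComponentIn (Ω \ sphere z (C * bdryDist Ω z)) x₀) →
        volume.real E ≤ M * bdryDist Ω z ^ n := by
  have hn0 : n ≠ 0 := by omega
  have hpos := fun z => bdryDist_pos hn0 hΩ hb (x := z)
  set δ := bdryDist Ω x₀ / 2 with hδ
  have hδpos : 0 < δ := half_pos (hpos x₀ hx₀)
  obtain ⟨M, hM, H⟩ := h.exists_measure_le hn hp0 hptop hΩ hb hδpos
    ((ball_subset_ball (half_le_self (hpos x₀ hx₀).le)).trans (ball_bdryDist_subset hx₀))
  set β := volume.real (ball (0 : Euc n) 1) with hβ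
  set c := δ / (1 + C) with hc
  have hcpos : 0 < c := by positivity
  have hVtop : volume Ω ≠ ⊤ := hb.measure_lt_top.ne
  refine ⟨max (M.toReal * ((2 * C) ^ n * β)) (volume.real Ω / c ^ n), by positivity, ?_⟩
  intro z hz E hE hEB hEU
  have hρ := hpos z hz
  rcases le_or_gt (C * bdryDist Ω z + δ) (dist x₀ z) with hd | hd
  · have h1 := ENNReal.toReal_mono (ENNReal.mul_ne_top hM measure_closedBall_lt_top.ne)
      (H z _ (by positivity) hd E hE hEB hEU)
    rw [ENNReal.toReal_mul, ← measureReal_def, ← measureReal_def,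
      Measure.addHaar_real_closedBall _ _ (by positivity), finrank_euclideanSpace_fin] at h1
    calc volume.real E ≤ _ := h1
      _ = M.toReal * ((2 * C) ^ n * β) * bdryDist Ω z ^ n := by rw [hβ]; ring
      _ ≤ _ := by gcongr; exact le_max_left _ _
  · have h1 := bdryDist_le_add_dist Ω x₀ z
    have h2 : c ≤ bdryDist Ω z := by
      rw [hc, div_le_iff₀ (by positivity)]
      nlinarith
    calc volume.real E ≤ volume.real Ω := measureReal_mono hE hVtop
      _ = volume.real Ω / c ^ n * c ^ n := by field_simp
      _ ≤ volume.real Ω / c ^ n * bdryDist Ω z ^ n := by gcongr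
      _ ≤ _ := by gcongr; exact le_max_right _ _

/-! ### Volumes along a chain -/

/-- Along points `y₀, …, y_k` in which no point enters the half-size Whitney ball of an earlier
one, and such that the earlier points far from `y_k` are separated from `x₀` by the sphere around
`y_k`, the volumes of Whitney balls sum up to at most a multiple of the last one. -/
theorem sum_bdryDist_pow_le {n : ℕ} (hn : n ≠ 0) {Ω : Set (Euc n)} {x₀ : Euc n} {C M : ℝ}
    (hb : Bornology.IsBounded Ω) (hC : 1 ≤ C)
    (hM : ∀ z ∈ Ω, ∀ E ⊆ Ω, Disjoint E (ball z (2 * (C * bdryDist Ω z))) →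
        Disjoint E (connectedComponentIn (Ω \ sphere z (C * bdryDist Ω z)) x₀) →
        volume.real E ≤ M * bdryDist Ω z ^ n)
    (y : ℕ → Euc n) (k : ℕ) (hy : ∀ i ≤ k, y i ∈ Ω) (hpos : ∀ i ≤ k, 0 < bdryDist Ω (y i))
    (hsep : ∀ i, ∀ j ≤ k, i < j → bdryDist Ω (y i) / 2 ≤ dist (y i) (y j))
    (hcut : ∀ i < k, y i ∉ ball (y k) (C * bdryDist Ω (y k)) →
      y i ∉ connectedComponentIn (Ω \ sphere (y k) (C * bdryDist Ω (y k))) x₀) :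
    ∑ i ∈ Finset.range k, bdryDist Ω (y i) ^ n ≤
      5 ^ n * (M / volume.real (ball (0 : Euc n) 1) + (5 * C) ^ n) * bdryDist Ω (y k) ^ n := by
  set a : ℕ → ℝ := fun i => bdryDist Ω (y i) with ha
  set r := C * a k with hr
  set β := volume.real (ball (0 : Euc n) 1) with hβ
  have hβpos : 0 < β := ENNReal.toReal_pos (measure_ball_pos volume _ one_pos).ne'
    measure_ball_lt_top.ne
  have hlt : ∀ {i}, i ∈ Finset.range k → i < k := fun h => Finset.mem_range.1 h
  have hlip : ∀ i j, a i ≤ a j + dist (y i) (y j) := fun i j => bdryDist_le_add_dist Ω _ _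
  have hak : 0 < a k := hpos k le_rfl
  have har : a k ≤ r := by rw [hr]; nlinarith
  have hbΩ : ∀ i < k, ball (y i) (a i / 5) ⊆ Ω := fun i hi =>
    (ball_subset_ball (by linarith [hpos i hi.le])).trans (ball_bdryDist_subset (hy i hi.le))
  -- with `d` the distance of the centres, `a i ≤ 2 d` and `a j ≤ a i + d ≤ 3 d`
  have hdisj' : ∀ i j, i < j → j < k → Disjoint (ball (y i) (a i / 5)) (ball (y j) (a j / 5)) := by
    intro i j hij hj
    refine ball_disjoint_ball ?_
    have h1 := hsep i j hj.le hij
    have h2 := hlip j i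
    rw [dist_comm] at h2
    linarith
  have hdisj : PairwiseDisjoint (Finset.range k : Set ℕ) fun i => ball (y i) (a i / 5) := by
    intro i hi j hj hij
    rcases hij.lt_or_gt with h | h
    · exact hdisj' i j h (hlt hj)
    · exact (hdisj' j i h (hlt hi)).symm
  set B := ⋃ i ∈ Finset.range k, ball (y i) (a i / 5) with hB
  have hBΩ : B ⊆ Ω := iUnion₂_subset fun i hi => hbΩ i (hlt hi)
  have hBtop : volume B ≠ ⊤ := (hb.subset hBΩ).measure_lt_top.ne
  have hsum : volume.real B = (∑ i ∈ Finset.range k, a i ^ n) * (β / 5 ^ n) := by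
    rw [hB, measureReal_biUnion_finset hdisj (fun i _ => measurableSet_ball)
      (fun i _ => measure_ball_lt_top.ne), Finset.sum_mul]
    refine Finset.sum_congr rfl fun i hi => ?_
    rw [volume_real_ball hn _ (by linarith [hpos i (hlt hi).le]), div_pow]
    ring
  -- a small ball that leaves `B(y k, 5 r)` has its centre outside `B(y k, 4 r)`
  have hfar : ∀ q ∈ B \ ball (y k) (5 * r), ∃ i < k, q ∈ ball (y i) (a i / 5) ∧
      4 * r ≤ dist (y i) (y k) := by
    rintro q ⟨hq, hqr⟩
    obtain ⟨i, hi, hqi⟩ := mem_iUnion₂.1 hq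
    refine ⟨i, hlt hi, hqi, ?_⟩
    by_contra! h
    have h1 := hlip i k
    have h2 := dist_triangle q (y i) (y k)
    rw [mem_ball] at hqi
    exact hqr (mem_ball.2 (by linarith))
  have hE : volume.real (B \ ball (y k) (5 * r)) ≤ M * a k ^ n := by
    refine hM (y k) (hy k le_rfl) _ (sdiff_subset.trans hBΩ) ?_ ?_
    · exact disjoint_sdiff_left.mono_right (ball_subset_ball (by linarith))
    · refine disjoint_left.2 fun q hq hqU => ?_
      obtain ⟨i, hi, hqi, hd⟩ := hfar q hq
      have hball : ball (y i) (a i / 5) ⊆ Ω \ sphere (y k) r := fun s hs => by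
        refine ⟨hbΩ i hi hs, fun hss => ?_⟩
        have h1 := hlip i k
        have h2 := dist_triangle (y i) s (y k)
        rw [mem_ball, dist_comm] at hs
        rw [mem_sphere] at hss
        linarith
      have hsub := subset_connectedComponentIn_of_inter_nonempty
        (convex_ball (y i) (a i / 5)).isPreconnected hball ⟨q, hqi, hqU⟩
      refine hcut i hi (fun h => ?_) (hsub (mem_ball_self (by linarith [hpos i hi.le])))
      rw [mem_ball] at h
      linarith
  have htot : volume.real B ≤ M * a k ^ n + (5 * C) ^ n * a k ^ n * β := by
    have h1 : volume.real B ≤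
        volume.real (B \ ball (y k) (5 * r)) + volume.real (ball (y k) (5 * r)) :=
      (measureReal_mono (by rw [sdiff_union_self]; exact subset_union_left)
        ((measure_union_lt_top ((measure_mono sdiff_subset).trans_lt hBtop.lt_top)
          measure_ball_lt_top).ne)).trans (measureReal_union_le _ _)
    rw [volume_real_ball hn _ (by linarith),
      show (5 * r) ^ n = (5 * C) ^ n * a k ^ n by rw [hr, ← mul_pow, mul_assoc]] at h1
    linarith
  rw [hsum, ← le_div_iff₀ (by positivity)] at htot
  refine htot.trans_eq ?_
  field_simp
  exact mul_comm _ _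

end KornJohn

/-! ### The John condition -/

theorem theorem4p1 (n : ℕ) (hn : 2 ≤ n) (Ω : Set (KornJohn.Euc n))
    (hΩ_open : IsOpen Ω) (hΩ_conn : IsConnected Ω) (hΩ_bdd : Bornology.IsBounded Ω)
    (p : ℝ≥0∞) (hp_one : 1 < p) (hp_top : p < ⊤)
    (hKorn : KornJohn.KornInequality Ω p)
    (x₀ : KornJohn.Euc n) (hsep : KornJohn.SeparationProperty Ω x₀) :
    KornJohn.IsJohnDomain Ω x₀ := by
  obtain ⟨hx₀, C, hC, hcurve⟩ := hsep
  have hn0 : n ≠ 0 := by omega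
  have hpos : ∀ x ∈ Ω, 0 < KornJohn.bdryDist Ω x := fun x hx =>
    KornJohn.bdryDist_pos hn0 hΩ_open hΩ_bdd hx
  obtain ⟨M, hM0, hM⟩ := hKorn.exists_measureReal_le_bdryDist hn
    (zero_lt_one.trans hp_one).ne' hp_top.ne hΩ_open hΩ_bdd hx₀ hC
  obtain ⟨K, hK, hgeom⟩ := KornJohn.sum_le_of_sum_pow_le hn0
    (M := 5 ^ n * (M / MeasureTheory.volume.real (Metric.ball (0 : KornJohn.Euc n) 1)
      + (5 * C) ^ n)) (by positivity)
  refine ⟨hΩ_open, hΩ_conn, hΩ_bdd, hx₀, K⁻¹, inv_pos.2 hK, fun x hx => ?_⟩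
  obtain ⟨γ, hγ, hγΩ, hγ0, hγ1, hγsep⟩ := hcurve x hx
  obtain ⟨m, T, hT0, hTmem, hTmono, hTsep, hTstep, hTend⟩ := KornJohn.exists_chain hγ
    (d := fun t => KornJohn.bdryDist Ω (γ t) / 2)
    (((KornJohn.continuous_bdryDist Ω).comp_continuousOn hγ).div_const 2)
    (fun t ht => half_pos (hpos _ (hγΩ ht)))
  have hyΩ : ∀ i, γ (T i) ∈ Ω := fun i => hγΩ (hTmem i)
  have hsum : ∀ k ≤ m, ∑ i ∈ Finset.range (k + 1), KornJohn.bdryDist Ω (γ (T i)) ≤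
      K * KornJohn.bdryDist Ω (γ (T k)) := by
    refine hgeom (fun i => KornJohn.bdryDist Ω (γ (T i))) m (fun i _ => hpos _ (hyΩ i)) ?_
    intro k hk
    refine KornJohn.sum_bdryDist_pow_le hn0 hΩ_bdd hC hM (fun i => γ (T i)) k (fun i _ => hyΩ i)
      (fun i _ => hpos _ (hyΩ i)) (fun i j hj => hTsep i j (hj.trans hk)) fun i hi hnot => ?_
    have hmem : γ (T i) ∈ γ '' Set.Icc 0 (T k) := ⟨T i, ⟨(hTmem i).1, hTmono hi.le⟩, rfl⟩
    rcases hγsep (T k) (hTmem k) with h | h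
    · exact absurd (h hmem) hnot
    · exact h _ ⟨hmem, hnot⟩
  obtain ⟨l, σ, hl, hσ, hσΩ, hσ0, hσl, hJ⟩ := KornJohn.exists_unitSpeed_polygon hK
    (fun i => γ (T i)) m (fun i _ => hyΩ i) (fun i _ => hpos _ (hyΩ i)) (fun i _ => hTstep i) hsum
  refine ⟨l, σ, hl, hσ, hσΩ, ?_, ?_, hJ⟩
  · rw [hσ0, hT0, hγ0]
  · rw [hσl, hTend, hγ1]
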